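/- Let $n\ge 1$ and $r\ge 3$ be integers and let $S_1,S_r>0$ be real numbers with $S_r\le S_1^r\le n^{r-1}S_r$. Let $\tilde n>0$ be the real number with $\tilde n^{\,r-1}=S_1^r/S_r$, and put $N=\lceil\tilde n\rceil$. Consider the equation $$(1+\alpha(N-1))^r+(N-1)(1-\alpha)^r=N^r S_r S_1^{-r}\qquad(*)$$ for $\alpha\in\bigl(-\tfrac1{N-1},0\bigr]$ (to be read as $(-\infty,0]$ if $N=1$). If $N\ge 2$, then $(*)$ has exactly one root $\alpha$ in this interval, and $\alpha<0$ when $\tilde n$ is not an integer. For the root $\alpha$ (for any root $\alpha$, if $N=1$), all real numbers $x_1,\dots,x_n\ge 0$ with $x_1+\cdots+x_n=S_1$ and $x_1^r+\cdots+x_n^r=S_r$ satisfy $$E:=\sum_{1\le i<j\le n}(x_i-x_j)^2\ \le\ E^{\max}:=\frac{S_1^2}{N}\Bigl(n(N-1)\alpha^2+n-N\Bigr),$$ and $E^{\max}$ is the maximum of $E$, i.e. equality holds for some such $x_1,\dots,x_n$. -/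

import Mathlib

/-- The potential energy `∑_{i < j} (x i - x j)²` of the real numbers `x 0, …, x (n - 1)`. -/
def potentialEnergy {n : ℕ} (x : Fin n → ℝ) : ℝ :=
  ∑ i, ∑ j ∈ Finset.Ioi i, (x i - x j) ^ 2

/-- The set of `n`-tuples of non-negative real numbers whose sum is `S₁` and whose `r`-th power
sum is `Sr`. -/
def powerSumSet (n r : ℕ) (S₁ Sr : ℝ) : Set (Fin n → ℝ) :=
  {x | (∀ i, 0 ≤ x i) ∧ ∑ i, x i = S₁ ∧ ∑ i, x i ^ r = Sr}

/-- The positive real number `ñ` with `ñ ^ (r - 1) = S₁ ^ r / Sr`. -/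
noncomputable def nTilde (r : ℕ) (S₁ Sr : ℝ) : ℝ :=
  (S₁ ^ r / Sr) ^ (1 / ((r : ℝ) - 1))

theorem nTilde_pos (r : ℕ) {S₁ Sr : ℝ} (h₁ : 0 < S₁) (hr : 0 < Sr) : 0 < nTilde r S₁ Sr :=
  Real.rpow_pos_of_pos (by positivity) _

theorem nTilde_pow {r : ℕ} (h : 2 ≤ r) {S₁ Sr : ℝ} (h₁ : 0 < S₁) (hr : 0 < Sr) :
    nTilde r S₁ Sr ^ (r - 1) = S₁ ^ r / Sr := by
  have h0 : 0 ≤ S₁ ^ r / Sr := by positivity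
  have hc : ((r - 1 : ℕ) : ℝ) = (r : ℝ) - 1 := by
    rw [Nat.cast_sub (by omega)]; simp
  have hne : r - 1 ≠ 0 := by omega
  rw [nTilde, ← hc, one_div, Real.rpow_inv_natCast_pow h0 hne]

/-- `α` is a root of `(1 + α (N - 1)) ^ r + (N - 1) (1 - α) ^ r = N ^ r Sr S₁ ^ (-r)` that lies in
the interval `(-1 / (N - 1), 0]`. The left end of the interval is written without division; for
`N = 1` it is `-∞`. -/
def IsEnergyRoot (r N : ℕ) (S₁ Sr α : ℝ) : Prop :=
  -1 < α * ((N : ℝ) - 1) ∧ α ≤ 0 ∧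
    (1 + α * ((N : ℝ) - 1)) ^ r + ((N : ℝ) - 1) * (1 - α) ^ r = (N : ℝ) ^ r * Sr / S₁ ^ r

/-!
Since `E = n ∑ xᵢ² - S₁²`, the task is to maximise the sum of squares when the sum and the `r`-th
power sum are given. It is solved in the dual form: fix the sum and the sum of squares, and minimise
the `r`-th power sum, which is possible by compactness.

A minimiser has no three entries `x > y ≥ z > 0`. Indeed, lowering `z` slightly while keeping
`x + y + z` and `x² + y² + z²` lowers the product `xyz`, and for fixed first two elementary
symmetric functions every power sum of order at least 3 increases with the product
(`pow_add_pow_add_pow_lt_of_mul_lt`, `exists_pow_add_pow_add_pow_lt`). Hence a minimiser consists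
of `k` entries `a`, at most one entry `b` strictly between `0` and `a`, and zeros
(`exists_two_level_pow_sum_le`).

With `a = S₁ (1 - β) / (k + 1)` and `b = S₁ (1 + β k) / (k + 1)`, the power sums of such a tuple are
values of `tiltedPowerSum k q` at `β ∈ [-1 / k, 0]`, where this function is strictly decreasing
(`tiltedPowerSum_strictAntiOn`). This monotonicity gives existence and uniqueness of the root `α`,
and it shows that a tuple of this shape with `r`-th power sum at most `Sr` has sum of squares at
most that of the tuple given by `α` (`sum_sq_le_of_tiltedPowerSum_eq`). The latter tuple, padded with
zeros, attains the bound.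
-/

/-! ### Power sums of three positive numbers -/

/-- With `e₁ = x + y + z` and `e₂ = xy + yz + zx` fixed, the power sums of order `≥ 3` of positive
reals increase strictly with the product `xyz`. The difference `d m` of the two power sums
satisfies `(E - x) (E - y) (E - z) d = c p`, where `E` is the shift, `c` the drop of the product
and `p` the power sum of the new triple, and `d 0 = d 1 = d 2 = 0`. -/
theorem pow_add_pow_add_pow_lt_of_mul_lt {x y z x' y' z' : ℝ} (hx : 0 < x) (hy : 0 < y)
    (hz : 0 < z) (hx' : 0 < x') (hy' : 0 < y') (hz' : 0 < z')
    (h₁ : x' + y' + z' = x + y + z) (h₂ : x' ^ 2 + y' ^ 2 + z' ^ 2 = x ^ 2 + y ^ 2 + z ^ 2)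
    (h₃ : x' * y' * z' < x * y * z) {r : ℕ} (hr : 3 ≤ r) :
    x' ^ r + y' ^ r + z' ^ r < x ^ r + y ^ r + z ^ r := by
  have he₂ : x' * y' + y' * z' + z' * x' = x * y + y * z + z * x := by
    linear_combination (x' + y' + z' + x + y + z) / 2 * h₁ - h₂ / 2
  set d : ℕ → ℝ := fun m => (x ^ m + y ^ m + z ^ m) - (x' ^ m + y' ^ m + z' ^ m) with hd
  set u : ℕ → ℝ := fun m => d (m + 1) - x * d m with hu
  set v : ℕ → ℝ := fun m => u (m + 1) - y * u m with hv
  have hd0 : d 0 = 0 := by simp [hd]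
  have hd1 : d 1 = 0 := by simp only [hd, pow_one]; linarith
  have hd2 : d 2 = 0 := by simp only [hd]; linarith
  have hrec (m : ℕ) : v (m + 1) - z * v m =
      (x * y * z - x' * y' * z') * (x' ^ m + y' ^ m + z' ^ m) := by
    have hcubic (t : ℝ) (ht : (t - x') * (t - y') * (t - z') = 0) :
        t ^ m * ((t - x) * (t - y) * (t - z)) = t ^ m * (x' * y' * z' - x * y * z) := by
      linear_combination t ^ m * ht + t ^ m * t ^ 2 * h₁ - t ^ m * t * he₂
    have hx3 := hcubic x' (by ring)
    have hy3 := hcubic y' (by ring)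
    have hz3 := hcubic z' (by ring)
    simp only [hv, hu, hd]
    linear_combination -hx3 - hy3 - hz3
  have hv_pos (m : ℕ) : 0 < v (m + 1) := by
    have hp (m : ℕ) : 0 < (x * y * z - x' * y' * z') * (x' ^ m + y' ^ m + z' ^ m) :=
      mul_pos (by linarith) (by positivity)
    induction m with
    | zero =>
      have h0 : v 0 = 0 := by simp [hv, hu, hd0, hd1, hd2]
      have h := hrec 0
      rw [h0] at h
      linarith [hp 0]
    | succ m ih => linarith [hrec (m + 1), hp (m + 1), mul_pos hz ih]
  have hu_pos (m : ℕ) : 0 < u (m + 2) := by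
    induction m with
    | zero =>
      have h1 : v 1 = u 2 - y * u 1 := rfl
      have h0 : v 0 = u 1 - y * u 0 := rfl
      have hv0 : v 0 = 0 := by simp [hv, hu, hd0, hd1, hd2]
      have hu0 : u 0 = 0 := by simp [hu, hd0, hd1]
      have hu1 : u 1 = 0 := by rw [hv0, hu0] at h0; linarith
      have h := hv_pos 0
      rw [zero_add, h1, hu1] at h
      simpa using h
    | succ m ih =>
      have h : v (m + 2) = u (m + 3) - y * u (m + 2) := rfl
      linarith [hv_pos (m + 1), mul_pos hy ih]
  have hd_pos (m : ℕ) : 0 < d (m + 3) := by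
    induction m with
    | zero =>
      have h : u 2 = d 3 - x * d 2 := rfl
      have := hu_pos 0
      rw [zero_add, h, hd2] at this
      simpa using this
    | succ m ih =>
      have h : u (m + 3) = d (m + 4) - x * d (m + 3) := rfl
      linarith [hu_pos (m + 1), mul_pos hx ih]
  obtain ⟨m, rfl⟩ := Nat.exists_eq_add_of_le' hr
  have := hd_pos m
  simp only [hd] at this
  linarith

/-- A positive triple whose largest entry is strictly larger than the other two can be moved, with
its sum and its sum of squares fixed, so that all higher power sums drop: lower the smallest
entry slightly, and let the other two solve the resulting quadratic equation. -/
theorem exists_pow_add_pow_add_pow_lt {x y z : ℝ} (hz : 0 < z) (hzy : z ≤ y) (hyx : y < x) :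
    ∃ x' y' z' : ℝ, 0 < x' ∧ 0 < y' ∧ 0 < z' ∧ x' + y' + z' = x + y + z ∧
      x' ^ 2 + y' ^ 2 + z' ^ 2 = x ^ 2 + y ^ 2 + z ^ 2 ∧
      ∀ r : ℕ, 3 ≤ r → x' ^ r + y' ^ r + z' ^ r < x ^ r + y ^ r + z ^ r := by
  have hy : 0 < y := hz.trans_le hzy
  have hx : 0 < x := hy.trans hyx
  -- the discriminant of the quadratic with roots `x'`, `y'`, when the third entry is `t`
  set D : ℝ → ℝ := fun t => 2 * (x ^ 2 + y ^ 2 + z ^ 2 - t ^ 2) - (x + y + z - t) ^ 2 with hD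
  have hDc : Continuous D := by fun_prop
  have hDz : D z = (x - y) ^ 2 := by simp only [hD]; ring
  have hsq : √(D z) = x - y := by rw [hDz, Real.sqrt_sq (by linarith)]
  have e1 : ∀ᶠ t in nhdsWithin z (Set.Iio z), 0 < D t :=
    (hDc.continuousAt.eventually_const_lt (by rw [hDz]; nlinarith)).filter_mono
      nhdsWithin_le_nhds
  have hm : Continuous fun t => (x + y + z - t) - √(D t) := by fun_prop
  have e2 : ∀ᶠ t in nhdsWithin z (Set.Iio z), 0 < (x + y + z - t) - √(D t) :=
    (hm.continuousAt.eventually_const_lt (by simp only [hsq]; linarith)).filter_mono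
      nhdsWithin_le_nhds
  have e3 : ∀ᶠ t in nhdsWithin z (Set.Iio z), 0 < t :=
    (continuousAt_id.eventually_const_lt hz).filter_mono nhdsWithin_le_nhds
  obtain ⟨t, ⟨⟨ht1, ht2⟩, ht3⟩, ht4⟩ := (((e1.and e2).and e3).and self_mem_nhdsWithin).exists
  have ht4 : t < z := ht4
  have hs := Real.sq_sqrt ht1.le
  have hs0 := Real.sqrt_nonneg (D t)
  simp only [hD] at hs
  set s := √(D t)
  have hx' : 0 < ((x + y + z - t) + s) / 2 := by linarith
  have hy' : 0 < ((x + y + z - t) - s) / 2 := by linarith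
  have h₁ : ((x + y + z - t) + s) / 2 + ((x + y + z - t) - s) / 2 + t = x + y + z := by ring
  have h₂ : (((x + y + z - t) + s) / 2) ^ 2 + (((x + y + z - t) - s) / 2) ^ 2 + t ^ 2 =
      x ^ 2 + y ^ 2 + z ^ 2 := by linear_combination hs / 2
  have h₃ : ((x + y + z - t) + s) / 2 * (((x + y + z - t) - s) / 2) * t < x * y * z := by
    have h : ((x + y + z - t) + s) / 2 * (((x + y + z - t) - s) / 2) * t - x * y * z =
        -((x - t) * (y - t) * (z - t)) := by linear_combination -t / 4 * hs
    have : 0 < (x - t) * (y - t) * (z - t) :=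
      mul_pos (mul_pos (by linarith) (by linarith)) (by linarith)
    linarith
  exact ⟨_, _, t, hx', hy', ht3, h₁, h₂, fun r hr =>
    pow_add_pow_add_pow_lt_of_mul_lt hx hy hz hx' hy' ht3 h₁ h₂ h₃ hr⟩

theorem sum_update_three {ι : Type*} [Fintype ι] [DecidableEq ι] {i j k : ι} (hij : i ≠ j)
    (hik : i ≠ k) (hjk : j ≠ k) (x : ι → ℝ) (a b c : ℝ) (f : ℝ → ℝ) :
    ∑ l, f (Function.update (Function.update (Function.update x i a) j b) k c l) =
      ∑ l, f (x l) + (f a + f b + f c - (f (x i) + f (x j) + f (x k))) := by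
  have h : ∑ l, (f (Function.update (Function.update (Function.update x i a) j b) k c l) -
      f (x l)) = f a + f b + f c - (f (x i) + f (x j) + f (x k)) := by
    rw [← Finset.sum_subset (Finset.subset_univ {i, j, k})]
    · rw [Finset.sum_insert (by simp [hij, hik]), Finset.sum_pair hjk]
      simp [Function.update_of_ne, hij, hik, hjk]
      ring
    · intro l _ hl
      simp only [Finset.mem_insert, Finset.mem_singleton, not_or] at hl
      simp [Function.update_of_ne, hl]
  rw [Finset.sum_sub_distrib] at h
  linarith

/-! ### Minimisers of a power sum for given sum and sum of squares -/

/-- Among the nonnegative tuples with the sum and the sum of squares of `x`, the `r`-th power sum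
is smallest at some tuple with `k` entries equal to `a`, one entry `b ≤ a`, and zeros; `b = 0`
stands for the case without a middle entry. -/
theorem exists_two_level_pow_sum_le {n r : ℕ} (hr : 3 ≤ r) {S : ℝ} (hS : 0 < S) {x : Fin n → ℝ}
    (hx : ∀ i, 0 ≤ x i) (hxS : ∑ i, x i = S) :
    ∃ (k : ℕ) (a b : ℝ), 1 ≤ k ∧ 0 ≤ b ∧ b ≤ a ∧ k * a + b = S ∧
      k * a ^ 2 + b ^ 2 = ∑ i, x i ^ 2 ∧ k * a ^ r + b ^ r ≤ ∑ i, x i ^ r := by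
  classical
  set K : Set (Fin n → ℝ) :=
    {y | (∀ i, 0 ≤ y i) ∧ ∑ i, y i = S ∧ ∑ i, y i ^ 2 = ∑ i, x i ^ 2} with hK
  have hKc : IsCompact K := by
    refine (isCompact_Icc (a := fun _ : Fin n => (0 : ℝ)) (b := fun _ => S)).of_isClosed_subset
      ?_ ?_
    · refine IsClosed.inter (s₁ := {y : Fin n → ℝ | ∀ i, 0 ≤ y i}) ?_ (IsClosed.inter
        (s₁ := {y : Fin n → ℝ | ∑ i, y i = S})
        (s₂ := {y : Fin n → ℝ | ∑ i, y i ^ 2 = ∑ i, x i ^ 2}) ?_ ?_)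
      · simp only [Set.ofPred_forall]
        exact isClosed_iInter fun i => isClosed_le continuous_const (continuous_apply i)
      · exact isClosed_eq (by fun_prop) continuous_const
      · exact isClosed_eq (by fun_prop) continuous_const
    · rintro y ⟨h0, h1, -⟩
      exact ⟨h0, fun i => h1 ▸ Finset.single_le_sum (fun j _ => h0 j) (Finset.mem_univ i)⟩
  obtain ⟨y, ⟨hy0, hyS, hy2⟩, hmin⟩ := hKc.exists_isMinOn ⟨x, hx, hxS, rfl⟩
    (f := fun y : Fin n → ℝ => ∑ i, y i ^ r) (by fun_prop)
  have hxr : ∑ i, y i ^ r ≤ ∑ i, x i ^ r := hmin ⟨hx, hxS, rfl⟩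
  -- a triple to which the move above applies would contradict minimality
  have htriple (i j k : Fin n) (hjk : j ≠ k) (hk : 0 < y k) (hkj : y k ≤ y j)
      (hji : y j < y i) : False := by
    have hij : i ≠ j := by rintro rfl; exact lt_irrefl _ hji
    have hik : i ≠ k := by rintro rfl; linarith
    obtain ⟨a, b, c, ha, hb, hc, h1, h2, h3⟩ := exists_pow_add_pow_add_pow_lt hk hkj hji
    have hmem : Function.update (Function.update (Function.update y i a) j b) k c ∈ K := by
      refine ⟨fun l => ?_, ?_, ?_⟩
      · simp only [Function.update_apply]
        split_ifs
        exacts [hc.le, hb.le, ha.le, hy0 l]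
      · rw [sum_update_three hij hik hjk y a b c fun t => t, hyS, h1]; ring
      · rw [sum_update_three hij hik hjk y a b c fun t => t ^ 2, hy2, h2]; ring
    have h := hmin hmem
    have hs := sum_update_three hij hik hjk y a b c fun t => t ^ r
    simp only [Set.mem_ofPred_eq] at h
    rw [hs] at h
    linarith [h3 r hr]
  have hne : Nonempty (Fin n) := by
    by_contra h
    rw [not_nonempty_iff] at h
    simp at hyS
    linarith
  obtain ⟨m, hm⟩ := Finite.exists_max y
  have hmid (j k : Fin n) (hj : 0 < y j) (hj' : y j < y m) (hk : 0 < y k) (hk' : y k < y m) :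
      j = k := by
    by_contra hjk
    rcases le_total (y k) (y j) with h | h
    · exact htriple m j k hjk hk h hj'
    · exact htriple m k j (Ne.symm hjk) hj h hk'
  have hcard : 1 ≤ (Finset.univ.filter fun i => y i = y m).card :=
    Finset.card_pos.2 ⟨m, by simp⟩
  by_cases hB : ∃ j, 0 < y j ∧ y j < y m
  · obtain ⟨j, hj, hjm⟩ := hB
    have hsum (q : ℕ) (hq : q ≠ 0) : ∑ i, y i ^ q =
        (Finset.univ.filter fun i => y i = y m).card * y m ^ q + y j ^ q := by
      have : ∀ i, y i ^ q = (if y i = y m then y m ^ q else 0) + if i = j then y j ^ q else 0 := by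
        intro i
        by_cases h1 : i = j
        · subst h1; simp [hjm.ne]
        · by_cases h2 : y i = y m
          · simp [h1, h2]
          · have h0 : y i = 0 := by
              by_contra h0
              exact h1 (hmid i j ((hy0 i).lt_of_ne' h0) ((hm i).lt_of_ne h2) hj hjm)
            rw [if_neg h2, if_neg h1, h0]
            simp [hq]
      rw [Finset.sum_congr rfl fun i _ => this i, Finset.sum_add_distrib, ← Finset.sum_filter]
      simp
    refine ⟨_, y m, y j, hcard, hj.le, hjm.le, ?_, ?_, ?_⟩
    · simpa [hyS] using (hsum 1 one_ne_zero).symm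
    · rw [← hsum 2 two_ne_zero, hy2]
    · rw [← hsum r (by omega)]; exact hxr
  · push Not at hB
    have hsum (q : ℕ) (hq : q ≠ 0) : ∑ i, y i ^ q =
        (Finset.univ.filter fun i => y i = y m).card * y m ^ q + 0 ^ q := by
      have : ∀ i, y i ^ q = if y i = y m then y m ^ q else 0 := by
        intro i
        by_cases h2 : y i = y m
        · simp [h2]
        · have h0 : y i = 0 := by
            by_contra h0
            exact h2 (le_antisymm (hm i) (hB i ((hy0 i).lt_of_ne' h0)))
          rw [if_neg h2, h0]
          simp [hq]
      rw [Finset.sum_congr rfl fun i _ => this i, ← Finset.sum_filter]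
      simp [hq]
    refine ⟨_, y m, 0, hcard, le_rfl, hy0 m, ?_, ?_, ?_⟩
    · simpa [hyS] using (hsum 1 one_ne_zero).symm
    · rw [← hsum 2 two_ne_zero, hy2]
    · rw [← hsum r (by omega)]; exact hxr

/-! ### The potential energy as a sum of squares -/

theorem two_mul_potentialEnergy {n : ℕ} (x : Fin n → ℝ) :
    2 * potentialEnergy x = ∑ i, ∑ j, (x i - x j) ^ 2 := by
  have h : ∑ i, ∑ j ∈ Finset.Ioi i, (x i - x j) ^ 2 = ∑ i, ∑ j ∈ Finset.Iio i, (x i - x j) ^ 2 := by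
    rw [Finset.sum_sigma', Finset.sum_sigma']
    refine Finset.sum_nbij' (fun p => ⟨p.2, p.1⟩) (fun p => ⟨p.2, p.1⟩) ?_ ?_ ?_ ?_ ?_
    all_goals simp
    intros; ring
  have hi (i : Fin n) : ∑ j, (x i - x j) ^ 2 =
      ∑ j ∈ Finset.Ioi i, (x i - x j) ^ 2 + ∑ j ∈ Finset.Iio i, (x i - x j) ^ 2 := by
    have hd : Disjoint (Finset.Ioi i) (Finset.Iio i) := by
      rw [Finset.disjoint_left]
      intro j h1 h2
      exact lt_asymm (Finset.mem_Ioi.1 h1) (Finset.mem_Iio.1 h2)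
    rw [← Finset.sum_union hd]
    refine (Finset.sum_subset (Finset.subset_univ _) fun j _ hj => ?_).symm
    have : j = i := by
      simp only [Finset.mem_union, Finset.mem_Ioi, Finset.mem_Iio, not_or, not_lt] at hj
      exact le_antisymm hj.1 hj.2
    simp [this]
  rw [Finset.sum_congr rfl fun i _ => hi i, Finset.sum_add_distrib, ← h, potentialEnergy]
  ring

theorem potentialEnergy_eq {n : ℕ} (x : Fin n → ℝ) :
    potentialEnergy x = n * ∑ i, x i ^ 2 - (∑ i, x i) ^ 2 := by
  have h : ∑ i, ∑ j, (x i - x j) ^ 2 = 2 * (n * ∑ i, x i ^ 2 - (∑ i, x i) ^ 2) := by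
    simp only [sub_sq, Finset.sum_add_distrib, Finset.sum_sub_distrib, Finset.sum_const,
      Finset.card_univ, Fintype.card_fin, nsmul_eq_mul, ← Finset.mul_sum, ← Finset.sum_mul]
    ring
  linarith [two_mul_potentialEnergy x]

/-! ### Power sums of tuples with two levels -/

/-- The `q`-th power sum of the `M + 1` numbers `1 + α M, 1 - α, …, 1 - α`. -/
def tiltedPowerSum (M q : ℕ) (α : ℝ) : ℝ :=
  (1 + α * M) ^ q + M * (1 - α) ^ q

theorem tiltedPowerSum_zero (M q : ℕ) : tiltedPowerSum M q 0 = M + 1 := by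
  simp [tiltedPowerSum, add_comm]

theorem tiltedPowerSum_two (M : ℕ) (α : ℝ) :
    tiltedPowerSum M 2 α = (M + 1) * (1 + M * α ^ 2) := by
  simp only [tiltedPowerSum]; ring

theorem continuous_tiltedPowerSum (M q : ℕ) : Continuous (tiltedPowerSum M q) := by
  unfold tiltedPowerSum; fun_prop

theorem tiltedPowerSum_strictAntiOn {M q : ℕ} (hM : 1 ≤ M) (hq : 2 ≤ q) :
    StrictAntiOn (tiltedPowerSum M q) (Set.Icc (-1 / M) 0) := by
  have hM0 : (0 : ℝ) < M := by exact_mod_cast hM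
  refine strictAntiOn_of_deriv_neg (convex_Icc _ _) (continuous_tiltedPowerSum M q).continuousOn
    fun α hα => ?_
  rw [interior_Icc] at hα
  obtain ⟨h1, h2⟩ := hα
  rw [div_lt_iff₀ hM0] at h1
  have hd : HasDerivAt (tiltedPowerSum M q)
      (q * (1 + α * M) ^ (q - 1) * (1 * M) + M * (q * (1 - α) ^ (q - 1) * (-1))) α :=
    ((((hasDerivAt_id α).mul_const (M : ℝ)).const_add 1).pow q).add
      ((((hasDerivAt_id α).const_sub 1).pow q).const_mul (M : ℝ))
  rw [hd.deriv]
  have hlt : (1 + α * M) ^ (q - 1) < (1 - α) ^ (q - 1) :=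
    pow_lt_pow_left₀ (by nlinarith) (by linarith) (by omega)
  have hq0 : (0 : ℝ) < q := by exact_mod_cast (by omega : 0 < q)
  have := mul_pos (mul_pos hq0 hM0) (sub_pos.2 hlt)
  linarith

/-- At the left end of the interval one of the `M + 1` numbers vanishes. -/
theorem tiltedPowerSum_left {M q : ℕ} (hM : 1 ≤ M) (hq : 1 ≤ q) :
    tiltedPowerSum M q (-1 / M) * (M : ℝ) ^ (q - 1) = (M + 1 : ℝ) ^ q := by
  have hM0 : (M : ℝ) ≠ 0 := by exact_mod_cast (by omega : M ≠ 0)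
  have h1 : (1 + -1 / (M : ℝ) * M) = 0 := by field_simp; ring
  have h2 : (1 - -1 / (M : ℝ)) = (M + 1) / M := by field_simp; ring
  obtain ⟨p, rfl⟩ := Nat.exists_eq_add_of_le' hq
  rw [tiltedPowerSum, h1, h2, div_pow, Nat.add_sub_cancel]
  field_simp
  ring

/-- The power sums of `k` numbers `a` and one number `b` depend only on the sum `S` and on the
parameter `α` with `a = S (1 - α) / (k + 1)`. -/
theorem two_level_pow_sum_eq {k : ℕ} {a b S : ℝ} (hS : 0 < S) (h : k * a + b = S) (q : ℕ) :
    k * a ^ q + b ^ q = (S / (k + 1)) ^ q * tiltedPowerSum k q (1 - (k + 1) * a / S) := by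
  have hk : (k + 1 : ℝ) ≠ 0 := by positivity
  have hS' := hS.ne'
  have ha : S / (k + 1) * (1 - (1 - (k + 1) * a / S)) = a := by field_simp; ring
  have hb : S / (k + 1) * (1 + (1 - (k + 1) * a / S) * k) = b := by
    rw [eq_sub_of_add_eq' h]; field_simp; ring
  rw [tiltedPowerSum, mul_add, mul_left_comm, ← mul_pow, ← mul_pow, ha, hb]
  ring

theorem exists_two_level_tuple {n k : ℕ} (hk : k + 1 ≤ n) {a b : ℝ} (ha : 0 ≤ a) (hb : 0 ≤ b) :
    ∃ x : Fin n → ℝ, (∀ i, 0 ≤ x i) ∧ ∀ q : ℕ, q ≠ 0 → ∑ i, x i ^ q = k * a ^ q + b ^ q := by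
  obtain ⟨m, rfl⟩ := Nat.exists_eq_add_of_le hk
  refine ⟨fun i => if (i : ℕ) < k then a else if (i : ℕ) = k then b else 0, fun i => ?_,
    fun q hq => ?_⟩
  · dsimp only
    split_ifs
    exacts [ha, hb, le_rfl]
  · rw [Fin.sum_univ_eq_sum_range
      (fun i => (if i < k then a else if i = k then b else 0) ^ q) (k + 1 + m),
      Finset.sum_range_add, Finset.sum_range_succ]
    have h1 : ∑ i ∈ Finset.range k, (if i < k then a else if i = k then b else 0) ^ q =
        k * a ^ q := by
      rw [Finset.sum_congr rfl fun i hi => by rw [if_pos (Finset.mem_range.1 hi)]]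
      simp
    have h2 : ∑ i ∈ Finset.range m, (if k + 1 + i < k then a else
        if k + 1 + i = k then b else 0) ^ q = 0 := by
      refine Finset.sum_eq_zero fun i _ => ?_
      rw [if_neg (by omega), if_neg (by omega), zero_pow hq]
    rw [h1, h2]
    simp

/-! ### The maximum of the potential energy -/

/-- The sum of squares of a nonnegative tuple with sum `S` and `r`-th power sum
`S ^ r / T ^ (r - 1)` is at most that of the numbers `1 + α M, 1 - α, …, 1 - α` scaled by
`S / (M + 1)`. The tuple is compared with a minimiser of the `r`-th power sum; the inequality
`M < T` excludes minimisers with at most `M` nonzero entries. -/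
theorem sum_sq_le_of_tiltedPowerSum_eq {n r M : ℕ} (hr : 3 ≤ r) {S T α : ℝ} (hS : 0 < S)
    (hT0 : 0 < T) (hMT : (M : ℝ) < T) {x : Fin n → ℝ} (hx0 : ∀ i, 0 ≤ x i)
    (hxS : ∑ i, x i = S) (hxr : (∑ i, x i ^ r) * T ^ (r - 1) = S ^ r) (h2 : α ≤ 0)
    (h3 : tiltedPowerSum M r α = (M + 1 : ℝ) ^ r / T ^ (r - 1)) :
    ∑ i, x i ^ 2 ≤ S ^ 2 / (M + 1) * (1 + M * α ^ 2) := by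
  have hr1 : r - 1 ≠ 0 := by omega
  have hrr : r = (r - 1) + 1 := by omega
  have hM1 : (0 : ℝ) < M + 1 := by positivity
  have hTr : 0 < T ^ (r - 1) := pow_pos hT0 _
  obtain ⟨k, a, b, hk, hb, hba, hab, h2sum, hrsum⟩ :=
    exists_two_level_pow_sum_le hr hS hx0 hxS
  rw [← h2sum]
  have ha : 0 ≤ a := hb.trans hba
  have hk0 : (0 : ℝ) < k := by exact_mod_cast hk
  -- the tilt of the minimising tuple
  set β : ℝ := 1 - (k + 1) * a / S with hβ
  have hβ0 : β ≤ 0 := by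
    rw [hβ, sub_nonpos, one_le_div hS]; linarith
  have hβ1 : -1 / (k : ℝ) ≤ β := by
    have : k * a ≤ S := by linarith
    rw [div_le_iff₀ hk0, hβ, sub_mul, div_mul_eq_mul_div, le_sub_comm, div_le_iff₀ hS]
    nlinarith
  have hβmem : β ∈ Set.Icc (-1 / (k : ℝ)) 0 := ⟨hβ1, hβ0⟩
  have hsum2 := two_level_pow_sum_eq hS hab 2
  have hsumr := two_level_pow_sum_eq hS hab r
  rw [hsumr] at hrsum
  have hβr : tiltedPowerSum k r β ≤ (k + 1 : ℝ) ^ r / T ^ (r - 1) := by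
    rw [le_div_iff₀ hTr]
    have h := mul_le_mul_of_nonneg_right hrsum hTr.le
    rw [hxr, div_pow, div_mul_eq_mul_div, div_mul_eq_mul_div, div_le_iff₀ (by positivity),
      mul_assoc] at h
    exact le_of_mul_le_mul_left h (by positivity)
  rcases lt_trichotomy k M with hkM | rfl | hkM
  · -- too few nonzero entries: the `r`-th power sum would exceed `S ^ r / T ^ (r - 1)`
    exfalso
    have hmin : tiltedPowerSum k r 0 ≤ tiltedPowerSum k r β :=
      (tiltedPowerSum_strictAntiOn hk (by omega : 2 ≤ r)).antitoneOn hβmem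
        ⟨hβ1.trans hβ0, le_rfl⟩ hβ0
    rw [tiltedPowerSum_zero] at hmin
    have h := hmin.trans hβr
    rw [le_div_iff₀ hTr, hrr, Nat.add_sub_cancel, pow_succ'] at h
    have h' := le_of_mul_le_mul_left h (by positivity)
    have hkT : (k + 1 : ℝ) < T := lt_of_le_of_lt (by exact_mod_cast hkM) hMT
    exact absurd h' (not_le.2 (pow_lt_pow_left₀ hkT (by positivity) hr1))
  · have hle : α ≤ β := by
      by_contra! hlt
      have := tiltedPowerSum_strictAntiOn hk (by omega : 2 ≤ r) hβmem
        ⟨hβ1.trans hlt.le, h2⟩ hlt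
      linarith
    rw [hsum2, ← hβ, tiltedPowerSum_two]
    have hsq : β ^ 2 ≤ α ^ 2 := by nlinarith
    calc (S / (k + 1)) ^ 2 * ((k + 1) * (1 + k * β ^ 2))
        = S ^ 2 / (k + 1) * (1 + k * β ^ 2) := by field_simp
      _ ≤ S ^ 2 / (k + 1) * (1 + k * α ^ 2) := by gcongr
  · -- many large entries: all entries are at most `S / (M + 1)`
    have hka : (M + 1 : ℝ) * a ≤ S := by
      have : (M + 1 : ℝ) ≤ k := by exact_mod_cast hkM
      nlinarith
    calc k * a ^ 2 + b ^ 2 ≤ S * a := by rw [← hab]; nlinarith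
      _ ≤ S ^ 2 / (M + 1) * 1 := by
        rw [mul_one, le_div_iff₀ hM1]; nlinarith
      _ ≤ S ^ 2 / (M + 1) * (1 + M * α ^ 2) := by
        gcongr
        exact le_add_of_nonneg_right (by positivity)

theorem theorem1p4 (n r : ℕ) (hr : 3 ≤ r) (S₁ Sr : ℝ) (hS₁ : 0 < S₁) (hSr : 0 < Sr)
    (hle : Sr ≤ S₁ ^ r) (hge : S₁ ^ r ≤ (n : ℝ) ^ (r - 1) * Sr)
    (N : ℕ) (hN : N = ⌈nTilde r S₁ Sr⌉₊) :
    (2 ≤ N → ∃! α : ℝ, IsEnergyRoot r N S₁ Sr α) ∧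
    ∀ α : ℝ, IsEnergyRoot r N S₁ Sr α →
      (nTilde r S₁ Sr < N → α < 0) ∧
      (∀ x ∈ powerSumSet n r S₁ Sr, potentialEnergy x ≤
        S₁ ^ 2 / N * (n * ((N : ℝ) - 1) * α ^ 2 + n - N)) ∧
      (∃ x ∈ powerSumSet n r S₁ Sr, potentialEnergy x =
        S₁ ^ 2 / N * (n * ((N : ℝ) - 1) * α ^ 2 + n - N)) := by
  have hT0 := nTilde_pos r hS₁ hSr
  have hTpow := nTilde_pow (r := r) (by omega) hS₁ hSr
  set T := nTilde r S₁ Sr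
  have hr1 : r - 1 ≠ 0 := by omega
  have hrr : r = (r - 1) + 1 := by omega
  have hNpos : 0 < N := hN ▸ Nat.ceil_pos.2 hT0
  have hTN : T ≤ N := hN ▸ Nat.le_ceil T
  have hTn : T ≤ n := by
    refine le_of_pow_le_pow_left₀ hr1 (Nat.cast_nonneg n) ?_
    rw [hTpow, div_le_iff₀ hSr]; exact hge
  have hNn : N ≤ n := hN ▸ Nat.ceil_le.2 hTn
  obtain ⟨M, rfl⟩ : ∃ M, N = M + 1 := ⟨N - 1, by omega⟩
  have hMT : (M : ℝ) < T := Nat.lt_ceil.1 (by omega)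
  push_cast at hTN
  have hM1 : (0 : ℝ) < M + 1 := by positivity
  have hS₁r : 0 < S₁ ^ r := pow_pos hS₁ r
  have hTr : 0 < T ^ (r - 1) := pow_pos hT0 _
  -- the right-hand side of the equation, in terms of `T`
  have hrhs : (M + 1 : ℝ) ^ r * Sr / S₁ ^ r = (M + 1 : ℝ) ^ r / T ^ (r - 1) := by
    rw [hTpow]; field_simp
  have hroot (α : ℝ) : IsEnergyRoot r (M + 1) S₁ Sr α ↔ -1 < α * M ∧ α ≤ 0 ∧
      tiltedPowerSum M r α = (M + 1 : ℝ) ^ r / T ^ (r - 1) := by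
    simp only [IsEnergyRoot, tiltedPowerSum, ← hrhs]
    push_cast
    simp only [add_sub_cancel_right]
  have hlower : (M + 1 : ℝ) ≤ (M + 1 : ℝ) ^ r / T ^ (r - 1) := by
    rw [le_div_iff₀ hTr]
    calc (M + 1 : ℝ) * T ^ (r - 1) ≤ (M + 1) * (M + 1 : ℝ) ^ (r - 1) := by gcongr
      _ = (M + 1 : ℝ) ^ r := by rw [← pow_succ', ← hrr]
  refine ⟨fun hN2 => ?_, fun α hα => ?_⟩
  · have hM : 1 ≤ M := by omega
    have hM0 : (0 : ℝ) < M := by exact_mod_cast hM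
    have hanti := tiltedPowerSum_strictAntiOn hM (by omega : 2 ≤ r)
    have hupper : (M + 1 : ℝ) ^ r / T ^ (r - 1) < tiltedPowerSum M r (-1 / M) := by
      rw [div_lt_iff₀ hTr, ← tiltedPowerSum_left hM (by omega : 1 ≤ r)]
      have hpos : 0 < tiltedPowerSum M r (-1 / M) := by
        have h := tiltedPowerSum_left hM (by omega : 1 ≤ r)
        have : 0 < tiltedPowerSum M r (-1 / M) * (M : ℝ) ^ (r - 1) := h ▸ by positivity
        exact pos_of_mul_pos_left this (by positivity)
      gcongr
    have hneg : (-1 / M : ℝ) ≤ 0 := div_nonpos_of_nonpos_of_nonneg (by norm_num) hM0.le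
    obtain ⟨α, ⟨h1, h2⟩, h3⟩ := intermediate_value_Icc' hneg
      (continuous_tiltedPowerSum M r).continuousOn
      ⟨(tiltedPowerSum_zero M r).trans_le hlower, hupper.le⟩
    refine ⟨α, (hroot α).2 ⟨?_, h2, h3⟩, fun β hβ => ?_⟩
    · rw [← div_lt_iff₀ hM0]
      refine h1.lt_of_ne ?_
      rintro rfl
      exact hupper.ne' h3
    · obtain ⟨g1, g2, g3⟩ := (hroot β).1 hβ
      exact hanti.injOn ⟨(div_lt_iff₀ hM0).2 g1 |>.le, g2⟩ ⟨h1, h2⟩ (g3.trans h3.symm)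
  obtain ⟨h1, h2, h3⟩ := (hroot α).1 hα
  have hEmax : S₁ ^ 2 / (M + 1 : ℕ) * (n * (((M + 1 : ℕ) : ℝ) - 1) * α ^ 2 + n - (M + 1 : ℕ)) =
      n * (S₁ ^ 2 / (M + 1) * (1 + M * α ^ 2)) - S₁ ^ 2 := by
    push_cast; field_simp; ring
  rw [hEmax]
  refine ⟨fun hlt => ?_, fun x hx => ?_, ?_⟩
  · refine h2.lt_of_ne ?_
    rintro rfl
    push_cast at hlt
    rw [tiltedPowerSum_zero, eq_div_iff hTr.ne', hrr, Nat.add_sub_cancel, pow_succ'] at h3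
    exact (pow_lt_pow_left₀ hlt hT0.le hr1).ne (mul_left_cancel₀ hM1.ne' h3)
  · obtain ⟨hx0, hxS, hxr⟩ := hx
    rw [potentialEnergy_eq, hxS]
    have h := sum_sq_le_of_tiltedPowerSum_eq hr hS₁ hT0 hMT hx0 hxS
      (by rw [hxr, hTpow]; field_simp) h2 h3
    gcongr
  · set a : ℝ := S₁ / (M + 1) * (1 - α) with ha
    set b : ℝ := S₁ / (M + 1) * (1 + α * M) with hb
    have hab : M * a + b = S₁ := by rw [ha, hb]; field_simp; ring
    have hα' : 1 - (M + 1) * a / S₁ = α := by rw [ha]; field_simp; ring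
    have hsum (q : ℕ) := two_level_pow_sum_eq hS₁ hab q
    rw [hα'] at hsum
    obtain ⟨x, hx0, hx⟩ := exists_two_level_tuple hNn
      (mul_nonneg (by positivity) (by linarith) : 0 ≤ a)
      (mul_nonneg (by positivity) (by linarith) : 0 ≤ b)
    have hxS : ∑ i, x i = S₁ := by
      have hx1 := hx 1 one_ne_zero
      simp only [pow_one] at hx1
      exact hx1.trans hab
    refine ⟨x, ⟨hx0, hxS, ?_⟩, ?_⟩
    · rw [hx r (by omega), hsum, h3, hTpow, div_pow]
      field_simp
    · rw [potentialEnergy_eq, hxS, hx 2 two_ne_zero, hsum, tiltedPowerSum_two]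
      field_simp
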